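/- Let $E$ be a finite set, partitioned into a set $W$ of working states and a set $F$ of failure states ($E=W\sqcup F$). Let $\{X(t)\}_{t\ge 0}$ be a time-homogeneous continuous-time Markov process with values in $E$, with right-continuous paths having left limits (almost surely), with initial probabilities $\alpha_i=\mathbb{P}[X(0)=i]$ and generator matrix $\mathbf{Q}=(q_{i,j})_{i,j\in E}$; that is, $q_{i,j}\ge 0$ for $i\ne j$, $q_{i,i}=-\sum_{j\neq i}q_{i,j}$, and the transition function $(P_{i,j}(t))$ of the process satisfies $q_{i,j}=\lim_{t\downarrow 0}P_{i,j}(t)/t$ for $i\neq j$ and $q_{i,i}=\lim_{t\downarrow 0}(P_{i,i}(t)-1)/t$. Let $N_i(t)$ be the number of transitions of the process during $(0,t]$ which lead from a state of $W$ to a different state of $W$, or from a state of $F$ to a different state of $F$. Then $N_i(t)$ is almost surely finite and integrable for every $t\ge 0$, and for every $t\ge 0$ the rate of inoccurrence \[ \mathrm{roi}(t):=\lim_{\Delta t\to 0}\frac{\mathbb{E}[N_i(t+\Delta t)-N_i(t)]}{\Delta t} \] (the limit being taken over $\Delta t\neq 0$ with $t+\Delta t\ge 0$) exists and is given by \[ \mathrm{roi}(t)=\sum_{i\in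 E}\Big(\sum_{w\in W}\ \sum_{w_1\in W,\ w_1\neq w}\alpha_i\,(e^{t\mathbf{Q}})_{i,w}\,q_{w,w_1}+\sum_{f\in F}\ \sum_{f_1\in F,\ f_1\neq f}\alpha_i\,(e^{t\mathbf{Q}})_{i,f}\,q_{f,f_1}\Big). \] -/

import Mathlib

open Filter Topology MeasureTheory
open scoped NNReal

/-- `Q` is a generator matrix: off-diagonal entries are nonnegative and
`q_{i,i} = -∑_{j ≠ i} q_{i,j}`. -/
structure IsGeneratorMatrix {E : Type*} [Fintype E] [DecidableEq E] (Q : Matrix E E ℝ) : Prop where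
  nonneg : ∀ i j, i ≠ j → 0 ≤ Q i j
  diag : ∀ i, Q i i = -∑ j with j ≠ i, Q i j

/-- `P` is a (time-homogeneous) transition function on the finite set `E`: every `P t` is a
stochastic matrix, `P 0` is the identity, and the Chapman–Kolmogorov equations hold. -/
structure IsTransitionFunction {E : Type*} [Fintype E] [DecidableEq E]
    (P : ℝ≥0 → Matrix E E ℝ) : Prop where
  nonneg : ∀ t i j, 0 ≤ P t i j
  row_sum : ∀ t i, ∑ j, P t i j = 1
  zero : P 0 = 1
  chapman_kolmogorov : ∀ s t, P (s + t) = P s * P t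

/-- The transition rates of `P` at time `0` are the entries of `Q`:
`q_{i,j} = lim_{t ↓ 0} P_{i,j}(t) / t` for `i ≠ j` and `q_{i,i} = lim_{t ↓ 0} (P_{i,i}(t) - 1) / t`. -/
def HasTransitionRates {E : Type*} [DecidableEq E]
    (P : ℝ≥0 → Matrix E E ℝ) (Q : Matrix E E ℝ) : Prop :=
  ∀ i j, Tendsto (fun t : ℝ≥0 => (P t i j - (if i = j then 1 else 0)) / (t : ℝ))
    (𝓝[>] 0) (𝓝 (Q i j))

/-- The σ-algebra `σ(X u : u ≤ s)`, where the state space carries the discrete σ-algebra. -/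
abbrev history {Ω E : Type*} (X : ℝ≥0 → Ω → E) (s : ℝ≥0) : MeasurableSpace Ω :=
  ⨆ u : Set.Iic s, MeasurableSpace.comap (X u) ⊤

/-- The path `x` in the discrete space `E` is right-continuous with left limits. -/
def IsCadlagPath {E : Type*} (x : ℝ≥0 → E) : Prop :=
  (∀ s, ∀ᶠ u in 𝓝[>] s, x u = x s) ∧ (∀ s, 0 < s → ∃ a, ∀ᶠ u in 𝓝[<] s, x u = a)

/-- `X` is, under `μ`, a continuous-time Markov process on the finite set `E` with generator matrix
`Q`, initial law `α` and (almost surely) càdlàg paths. The Markov property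
`ℙ[X(s+t) = j | A, X(s) = i] = P_{i,j}(t)`, for `A` in the past of time `s`, is written without
division, so that it is void exactly when the conditioning event is null. -/
structure IsMarkovProcess {Ω E : Type*} [MeasurableSpace Ω] [Fintype E] [DecidableEq E]
    (μ : Measure Ω) (X : ℝ≥0 → Ω → E) (α : E → ℝ) (Q : Matrix E E ℝ) : Prop where
  generator : IsGeneratorMatrix Q
  measurable : ∀ t j, MeasurableSet (X t ⁻¹' {j})
  initial : ∀ i, μ.real (X 0 ⁻¹' {i}) = α i
  markov : ∃ P : ℝ≥0 → Matrix E E ℝ, IsTransitionFunction P ∧ HasTransitionRates P Q ∧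
    ∀ (s t : ℝ≥0) (A : Set Ω), MeasurableSet[history X s] A → ∀ i j,
      μ.real (A ∩ X s ⁻¹' {i} ∩ X (s + t) ⁻¹' {j}) = μ.real (A ∩ X s ⁻¹' {i}) * P t i j
  cadlag : ∀ᵐ ω ∂μ, IsCadlagPath fun t => X t ω

/-- The path `x` makes a transition from state `a` to the different state `b` at time `s > 0`:
its left limit at `s` is `a` and its value at `s` is `b`. -/
def IsTransitionAt {E : Type*} (x : ℝ≥0 → E) (s : ℝ≥0) (a b : E) : Prop :=
  0 < s ∧ (∀ᶠ u in 𝓝[<] s, x u = a) ∧ x s = b ∧ a ≠ b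

/-- `N_i(t)` along the path `x`: the number of transitions in `(0, t]` between two different states
of `W` or between two different states of `F`. -/
noncomputable def innerTransitionCount {E : Type*} (W F : Finset E) (x : ℝ≥0 → E) (t : ℝ≥0) : ℕ∞ :=
  {s : ℝ≥0 | s ≤ t ∧ ∃ a b, IsTransitionAt x s a b ∧
    ((a ∈ W ∧ b ∈ W) ∨ (a ∈ F ∧ b ∈ F))}.encard

/-- The real-valued random variable `N_i(t)` of the process `X` (it is a.s. finite for càdlàg
paths). -/
noncomputable def innerCount {Ω E : Type*} (W F : Finset E) (X : ℝ≥0 → Ω → E) (t : ℝ≥0) (ω : Ω) :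
    ℝ :=
  ((innerTransitionCount W F (fun u => X u ω) t).toNat : ℝ)

/-- `r` is the rate of inoccurrence at time `t`:
`lim_{Δt → 0} 𝔼[N_i(t + Δt) - N_i(t)] / Δt` exists and equals `r`. The increment `Δt ≠ 0` may have
either sign, subject to `t + Δt ≥ 0`. -/
def IsROI {Ω E : Type*} [MeasurableSpace Ω] (μ : Measure Ω) (W F : Finset E) (X : ℝ≥0 → Ω → E)
    (t : ℝ≥0) (r : ℝ) : Prop :=
  Tendsto
    (fun Δ : ℝ => (∫ ω, (innerCount W F X ((t : ℝ) + Δ).toNNReal ω - innerCount W F X t ω) ∂μ) / Δ)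
    (𝓝[{Δ : ℝ | Δ ≠ 0 ∧ 0 ≤ (t : ℝ) + Δ}] 0) (𝓝 r)

/-! Sample the path on the grid of mesh `t / n` and count the cells whose endpoints differ by an
admissible change of state (`gridCount`). A càdlàg path in a discrete space has finitely many jumps
in `(0, t]`, so on a fine grid each cell holds at most one and the grid count equals the true count
(`IsCadlagPath.eventually_gridCount_eq`). By the Markov property the expected grid count is a sum of
state probabilities times entries of `exp ((t / n) • Q)`; since these entries are asymptotic to `(t
/ n) * Q a b`, it is a Riemann sum tending to `meanCount`. Fatou's lemma makes the true count
integrable; dominated convergence then identifies its mean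
(`IsMarkovProcess.integral_ncard_transitionTimes`). The rate is the derivative of `meanCount`, by
the fundamental theorem of calculus. -/

/-! ### The transition semigroup is a matrix exponential. -/

section Semigroup

attribute [local instance] Matrix.linftyOpNormedRing Matrix.linftyOpNormedAlgebra

variable {E : Type*} [Fintype E] [DecidableEq E]

lemma IsTransitionFunction.norm_le_one {P : ℝ≥0 → Matrix E E ℝ} (hP : IsTransitionFunction P)
    (t : ℝ≥0) : ‖P t‖ ≤ 1 := by
  rw [Matrix.linfty_opNorm_def]
  norm_cast
  refine Finset.sup_le fun i _ => ?_
  rw [← NNReal.coe_le_coe]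
  push_cast
  simp_rw [Real.norm_of_nonneg (hP.nonneg t i _)]
  exact (hP.row_sum t i).le

lemma HasTransitionRates.hasDerivWithinAt_zero {P : ℝ≥0 → Matrix E E ℝ} {Q : Matrix E E ℝ}
    (hP : IsTransitionFunction P) (hQ : HasTransitionRates P Q) :
    HasDerivWithinAt (fun u : ℝ => P u.toNNReal) Q (Set.Ici 0) 0 := by
  refine hasDerivWithinAt_iff_tendsto_slope.2 ?_
  have hset : Set.Ici (0 : ℝ) \ {0} = Set.Ioi 0 := Set.Ici_sdiff_left
  rw [hset]
  refine tendsto_pi_nhds.2 fun i => tendsto_pi_nhds.2 fun j => ?_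
  have hmap : Tendsto Real.toNNReal (𝓝[>] (0 : ℝ)) (𝓝[>] 0) := by
    refine tendsto_nhdsWithin_iff.2 ⟨?_, ?_⟩
    · have := (continuous_real_toNNReal.tendsto 0).mono_left
        (nhdsWithin_le_nhds (s := Set.Ioi (0 : ℝ)))
      simpa using this
    · filter_upwards [self_mem_nhdsWithin] with u hu
      simpa using hu
  refine ((hQ i j).comp hmap).congr' ?_
  filter_upwards [self_mem_nhdsWithin] with u hu
  have hu : (0 : ℝ) < u := hu
  simp only [Function.comp_apply, slope, vsub_eq_sub, sub_zero, Real.toNNReal_zero, hP.zero,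
    Real.coe_toNNReal u hu.le, Matrix.smul_apply, Matrix.sub_apply, Matrix.one_apply, smul_eq_mul]
  rw [div_eq_inv_mul]

/-- Forward Kolmogorov equation from the right: for `u ≥ x`, `P u = P x * P (u - x)`, so only the
rates at `0` matter. -/
lemma HasTransitionRates.hasDerivWithinAt {P : ℝ≥0 → Matrix E E ℝ} {Q : Matrix E E ℝ}
    (hP : IsTransitionFunction P) (hQ : HasTransitionRates P Q) {x : ℝ} (hx : 0 ≤ x) :
    HasDerivWithinAt (fun u : ℝ => P u.toNNReal) (P x.toNNReal * Q) (Set.Ici x) x := by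
  have h0 := hQ.hasDerivWithinAt_zero hP
  have h1 : HasDerivWithinAt (fun u : ℝ => P (u - x).toNNReal) Q (Set.Ici x) x := by
    have hs : HasDerivWithinAt (fun u : ℝ => u - x) 1 (Set.Ici x) x :=
      (hasDerivWithinAt_id x _).sub_const x
    have h0' : HasDerivWithinAt (fun u : ℝ => P u.toNNReal) Q (Set.Ici 0) (x - x) := by
      rwa [sub_self]
    have := HasDerivWithinAt.scomp (h := fun u : ℝ => u - x) x h0' hs (fun u hu => by simpa using hu)
    rw [one_smul] at this
    exact this
  refine (h1.const_mul (P x.toNNReal)).congr_of_mem (fun u hu => ?_) Set.self_mem_Ici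
  have hu : x ≤ u := hu
  rw [← hP.chapman_kolmogorov, ← Real.toNNReal_add hx (sub_nonneg.2 hu), add_sub_cancel]

/-- Right derivatives say nothing about left continuity. That comes from `P u - P x = P u * (1 - P
(x - u))` for `u ≤ x`, with `‖P u‖ ≤ 1`. -/
lemma HasTransitionRates.continuousOn {P : ℝ≥0 → Matrix E E ℝ} {Q : Matrix E E ℝ}
    (hP : IsTransitionFunction P) (hQ : HasTransitionRates P Q) :
    ContinuousOn (fun u : ℝ => P u.toNNReal) (Set.Ici 0) := by
  intro x hx
  have hx : 0 ≤ x := hx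
  have hr := (hQ.hasDerivWithinAt hP hx).continuousWithinAt
  have hl : ContinuousWithinAt (fun u : ℝ => P u.toNNReal) (Set.Icc 0 x) x := by
    have h0 := (hQ.hasDerivWithinAt_zero hP).continuousWithinAt
    have h1 : Tendsto (fun u : ℝ => ‖P (x - u).toNNReal - 1‖) (𝓝[Set.Icc 0 x] x) (𝓝 0) := by
      have hm : Tendsto (fun u : ℝ => x - u) (𝓝[Set.Icc 0 x] x) (𝓝[≥] 0) := by
        refine tendsto_nhdsWithin_iff.2 ⟨?_, ?_⟩
        · have : Tendsto (fun u : ℝ => x - u) (𝓝 x) (𝓝 (x - x)) := by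
            exact (continuous_const.sub continuous_id).tendsto x
          rw [sub_self] at this
          exact this.mono_left nhdsWithin_le_nhds
        · filter_upwards [self_mem_nhdsWithin] with u hu
          simpa using hu.2
      have h2 := (h0.tendsto.comp hm).sub_const (1 : Matrix E E ℝ)
      simp only [Real.toNNReal_zero, hP.zero, sub_self] at h2
      simpa using h2.norm
    refine tendsto_iff_norm_sub_tendsto_zero.2 ?_
    refine squeeze_zero' (Eventually.of_forall fun _ => norm_nonneg _) ?_ h1
    filter_upwards [self_mem_nhdsWithin] with u hu
    have e : P x.toNNReal = P u.toNNReal * P (x - u).toNNReal := by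
      rw [← hP.chapman_kolmogorov, ← Real.toNNReal_add hu.1 (sub_nonneg.2 hu.2), add_sub_cancel]
    calc ‖P u.toNNReal - P x.toNNReal‖ = ‖P u.toNNReal * (P (x - u).toNNReal - 1)‖ := by
          rw [norm_sub_rev, e, mul_sub, mul_one]
      _ ≤ ‖P u.toNNReal‖ * ‖P (x - u).toNNReal - 1‖ := norm_mul_le _ _
      _ ≤ 1 * ‖P (x - u).toNNReal - 1‖ := by gcongr; exact hP.norm_le_one _
      _ = _ := one_mul _
  refine (hl.union hr).mono fun u hu => ?_
  rcases le_total u x with h | h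
  · exact Or.inl ⟨hu, h⟩
  · exact Or.inr h

/-- A transition function with rates `Q` is the matrix exponential semigroup of `Q`. -/
theorem HasTransitionRates.eq_exp {P : ℝ≥0 → Matrix E E ℝ} {Q : Matrix E E ℝ}
    (hP : IsTransitionFunction P) (hQ : HasTransitionRates P Q) (t : ℝ≥0) :
    P t = NormedSpace.exp ((t : ℝ) • Q) := by
  have hd : ∀ x : ℝ, HasDerivAt (fun u : ℝ => NormedSpace.exp (u • (-Q)))
      ((-Q) * NormedSpace.exp (x • (-Q))) x := fun x => hasDerivAt_exp_smul_const' (-Q) x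
  have hcont : ContinuousOn (fun u : ℝ => P u.toNNReal * NormedSpace.exp (u • (-Q)))
      (Set.Icc 0 t) :=
    ((hQ.continuousOn hP).mono Set.Icc_subset_Ici_self).mul
      fun x _ => (hd x).continuousAt.continuousWithinAt
  -- The product `P u * exp (-u Q)` is continuous with zero right derivative, hence constantly `1`.
  have key := constant_of_has_deriv_right_zero hcont (fun x hx => by
    have := (hQ.hasDerivWithinAt hP hx.1).mul (hd x).hasDerivWithinAt
    have e : P x.toNNReal * Q * NormedSpace.exp (x • (-Q)) +
        P x.toNNReal * ((-Q) * NormedSpace.exp (x • (-Q))) = 0 := by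
      rw [neg_mul, mul_neg, mul_assoc, add_neg_cancel]
    rw [e] at this
    exact this) t ⟨t.2, le_rfl⟩
  simp only [Real.toNNReal_coe, Real.toNNReal_zero, hP.zero, zero_smul, NormedSpace.exp_zero,
    mul_one] at key
  have h2 : NormedSpace.exp ((t : ℝ) • (-Q)) * NormedSpace.exp ((t : ℝ) • Q) = 1 := by
    rw [← Matrix.exp_add_of_commute]
    · simp
    · exact ((Commute.refl Q).neg_left.smul_left _).smul_right _
  calc P t = P t * (NormedSpace.exp ((t : ℝ) • (-Q)) * NormedSpace.exp ((t : ℝ) • Q)) := by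
        rw [h2, mul_one]
    _ = _ := by rw [← mul_assoc, key, one_mul]

lemma hasDerivAt_exp_smul_apply (Q : Matrix E E ℝ) (i j : E) (x : ℝ) :
    HasDerivAt (fun u : ℝ => NormedSpace.exp (u • Q) i j) ((NormedSpace.exp (x • Q) * Q) i j) x := by
  have h : HasDerivAt (fun u : ℝ => NormedSpace.exp (u • Q)) (NormedSpace.exp (x • Q) * Q) x :=
    hasDerivAt_exp_smul_const Q x
  exact hasDerivAt_pi.1 (hasDerivAt_pi.1 h i) j

end Semigroup

/-! ### Jumps of càdlàg paths and their detection on a grid. -/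

section Paths

variable {E : Type*}

/-- The times in `(0, t]` at which the path `x` makes a transition `a → b` with `R a b`. -/
def transitionTimes (R : E → E → Prop) (x : ℝ≥0 → E) (t : ℝ≥0) : Set ℝ≥0 :=
  {s | s ≤ t ∧ ∃ a b, IsTransitionAt x s a b ∧ R a b}

lemma not_isTransitionAt_of_eventually {x : ℝ≥0 → E} {s : ℝ≥0} {a b c : E}
    (h : ∀ᶠ u in 𝓝 s, x u = c) : ¬ IsTransitionAt x s a b := by
  rintro ⟨hs, ha, hb, hab⟩
  have : (𝓝[<] s).NeBot := nhdsLT_neBot_of_exists_lt ⟨0, hs⟩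
  obtain ⟨u, hu, hu'⟩ := (ha.and (h.filter_mono nhdsWithin_le_nhds)).exists
  exact hab (by rw [← hu, hu', ← h.self_of_nhds, hb])

/-- Every time has a punctured neighbourhood free of transitions. -/
lemma IsCadlagPath.eventually_not_isTransitionAt {x : ℝ≥0 → E} (hx : IsCadlagPath x) (s : ℝ≥0) :
    ∀ᶠ u in 𝓝[≠] s, ∀ a b, ¬ IsTransitionAt x u a b := by
  have key : ∀ (S : Set ℝ≥0) (c : E), IsOpen S → (∀ᶠ u in 𝓝[S] s, x u = c) →
      ∀ᶠ u in 𝓝[S] s, ∀ a b, ¬ IsTransitionAt x u a b := by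
    intro S c hS h
    filter_upwards [eventually_eventually_nhdsWithin.2 h, self_mem_nhdsWithin] with u hu huS a b
    rw [hS.nhdsWithin_eq huS] at hu
    exact not_isTransitionAt_of_eventually hu
  rw [← Set.Iio_union_Ioi, nhdsWithin_union, eventually_sup]
  refine ⟨?_, key _ _ isOpen_Ioi (hx.1 s)⟩
  rcases eq_or_ne s 0 with rfl | hs
  · simp
  · obtain ⟨a, ha⟩ := hx.2 s (pos_iff_ne_zero.2 hs)
    exact key _ _ isOpen_Iio ha

/-- Transition times are isolated from one another near every point of the compact interval `[0,
t]`. -/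
lemma IsCadlagPath.finite_transitionTimes {x : ℝ≥0 → E} (hx : IsCadlagPath x)
    (R : E → E → Prop) (t : ℝ≥0) : (transitionTimes R x t).Finite := by
  have h : (Set.Icc 0 t ∩ {s | ∃ a b, IsTransitionAt x s a b}).Finite := by
    refine (isCompact_Icc (a := (0 : ℝ≥0)) (b := t)).induction_on
      (p := fun S => (S ∩ {s | ∃ a b, IsTransitionAt x s a b}).Finite) (by simp)
      (fun S T hST hT => hT.subset (Set.inter_subset_inter_left _ hST))
      (fun S T hS hT => by rw [Set.union_inter_distrib_right]; exact hS.union hT) ?_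
    intro s _
    have := eventually_nhdsWithin_iff.1 (hx.eventually_not_isTransitionAt s)
    refine ⟨_, mem_nhdsWithin_of_mem_nhds this, (Set.finite_singleton s).subset ?_⟩
    rintro u ⟨hu, a, b, hab⟩
    by_contra hus
    exact hu hus a b hab
  refine h.subset ?_
  rintro s ⟨hs, a, b, hab, -⟩
  exact ⟨⟨zero_le, hs⟩, a, b, hab⟩

/-- Without jumps the path is continuous into the discrete space `E`, hence constant on the
connected set `[u, v]`. -/
lemma IsCadlagPath.eq_of_forall_not_isTransitionAt {x : ℝ≥0 → E} (hx : IsCadlagPath x)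
    {u v : ℝ≥0} (huv : u ≤ v) (h : ∀ s, u < s → s ≤ v → ∀ a b, ¬ IsTransitionAt x s a b) :
    x u = x v := by
  let _ : TopologicalSpace E := ⊥
  have : DiscreteTopology E := ⟨rfl⟩
  refine isPreconnected_Icc.constant (s := Set.Icc u v) (f := x) ?_
    (Set.left_mem_Icc.2 huv) (Set.right_mem_Icc.2 huv)
  intro s hs
  have hr : ∀ᶠ w in 𝓝[≥] s, x w = x s := by
    rw [← Set.Ioi_insert, nhdsWithin_insert, eventually_sup]
    exact ⟨by simp, hx.1 s⟩
  have hl : ∀ᶠ w in 𝓝[Set.Ico u s] s, x w = x s := by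
    rcases hs.1.eq_or_lt with rfl | hus
    · simp
    · obtain ⟨a, ha⟩ := hx.2 s (zero_le.trans_lt hus)
      have : a = x s := by
        by_contra hne
        exact h s hus hs.2 a (x s) ⟨zero_le.trans_lt hus, ha, rfl, hne⟩
      subst this
      exact ha.filter_mono (nhdsWithin_mono _ fun w hw => hw.2)
  have hboth : ∀ᶠ w in 𝓝[Set.Icc u v] s, x w = x s := by
    have : ∀ᶠ w in 𝓝[Set.Ico u s ∪ Set.Ici s] s, x w = x s := by
      rw [nhdsWithin_union, eventually_sup]
      exact ⟨hl, hr⟩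
    refine this.filter_mono (nhdsWithin_mono _ fun w hw => ?_)
    rcases lt_or_ge w s with h' | h'
    · exact Or.inl ⟨hw.1, h'⟩
    · exact Or.inr h'
  rw [ContinuousWithinAt, nhds_discrete, tendsto_pure]
  exact hboth

/-- If `s` is the only transition time in `(u, v]`, the path goes from `x u` to `x v` at `s`. -/
lemma IsCadlagPath.eq_of_unique_isTransitionAt {x : ℝ≥0 → E} (hx : IsCadlagPath x)
    {u v s : ℝ≥0} {a b : E} (hus : u < s) (hsv : s ≤ v) (hs : IsTransitionAt x s a b)
    (h : ∀ r, u < r → r ≤ v → (∃ a b, IsTransitionAt x r a b) → r = s) :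
    x u = a ∧ x v = b := by
  constructor
  · have : (𝓝[<] s).NeBot := nhdsLT_neBot_of_exists_lt ⟨0, hs.1⟩
    have hmem : ∀ᶠ w in 𝓝[<] s, u ≤ w ∧ w < s := by
      filter_upwards [self_mem_nhdsWithin, mem_nhdsWithin_of_mem_nhds (Ioi_mem_nhds hus)]
        with w hw hw'
      exact ⟨le_of_lt hw', hw⟩
    obtain ⟨w, hw, huw, hws⟩ := (hs.2.1.and hmem).exists
    rw [← hw]
    refine hx.eq_of_forall_not_isTransitionAt huw fun r hur hrw c d hcd => ?_
    have := h r hur (hrw.trans (hws.le.trans hsv)) ⟨c, d, hcd⟩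
    exact absurd hrw (by rw [this]; exact not_le.2 hws)
  · rw [← hs.2.2.1]
    refine (hx.eq_of_forall_not_isTransitionAt hsv fun r hsr hrv c d hcd => ?_).symm
    exact hsr.ne' (h r (hus.trans hsr) hrv ⟨c, d, hcd⟩)

/-- The number of indices `k < n` such that `x` has performed an `R`-change of state between the
times `k * h` and `(k + 1) * h`. -/
noncomputable def gridCount (R : E → E → Prop) (x : ℝ≥0 → E) (h : ℝ≥0) (n : ℕ) : ℕ :=
  open Classical in
  ∑ k ∈ Finset.range n, if x (k * h) ≠ x (k * h + h) ∧ R (x (k * h)) (x (k * h + h)) then 1 else 0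

lemma transitionTimes_eq_union (R : E → E → Prop) (x : ℝ≥0 → E) (u v : ℝ≥0) (huv : u ≤ v) :
    transitionTimes R x v = transitionTimes R x u ∪ (transitionTimes R x v ∩ Set.Ioc u v) := by
  ext s
  constructor
  · intro hs
    rcases le_or_gt s u with h | h
    · exact Or.inl ⟨h, hs.2⟩
    · exact Or.inr ⟨hs, h, hs.1⟩
  · rintro (hs | hs)
    · exact ⟨hs.1.trans huv, hs.2⟩
    · exact hs.1

lemma IsCadlagPath.ncard_transitionTimes_add {x : ℝ≥0 → E} (hx : IsCadlagPath x)
    (R : E → E → Prop) {u v : ℝ≥0} (huv : u ≤ v) :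
    (transitionTimes R x v).ncard =
      (transitionTimes R x u).ncard + (transitionTimes R x v ∩ Set.Ioc u v).ncard := by
  conv_lhs => rw [transitionTimes_eq_union R x u v huv]
  refine Set.ncard_union_eq ?_ (hx.finite_transitionTimes R u)
    ((hx.finite_transitionTimes R v).subset Set.inter_subset_left)
  rw [Set.disjoint_left]
  rintro s hs ⟨-, hs', -⟩
  exact absurd hs.1 (not_le.2 hs')

lemma transitionTimes_zero (R : E → E → Prop) (x : ℝ≥0 → E) : transitionTimes R x 0 = ∅ := by
  ext s
  simp only [transitionTimes, Set.mem_ofPred_eq, Set.mem_empty_iff_false, iff_false, not_and]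
  rintro hs ⟨a, b, hab, -⟩
  exact absurd hab.1 (not_lt.2 hs)

/-- A cell whose endpoints differ contains a jump, though perhaps not one of type `R`; hence the
bound by all transitions. It serves as the dominating function. -/
lemma IsCadlagPath.gridCount_le {x : ℝ≥0 → E} (hx : IsCadlagPath x) (R : E → E → Prop)
    (h : ℝ≥0) (n : ℕ) :
    gridCount R x h n ≤ (transitionTimes (fun _ _ => True) x (n * h)).ncard := by
  induction n with
  | zero => simp [gridCount]
  | succ n ih =>
    rw [gridCount, Finset.sum_range_succ]
    have e : ((n + 1 : ℕ) : ℝ≥0) * h = n * h + h := by push_cast; ring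
    rw [e, hx.ncard_transitionTimes_add _ (le_self_add : (n : ℝ≥0) * h ≤ n * h + h)]
    refine add_le_add ih ?_
    split_ifs with hc
    · rw [Nat.succ_le_iff, Set.ncard_pos
        ((hx.finite_transitionTimes _ _).subset Set.inter_subset_left)]
      by_contra hne
      refine hc.1 (hx.eq_of_forall_not_isTransitionAt le_self_add fun s hs hs' a b hab => hne ?_)
      exact ⟨s, ⟨hs', a, b, hab, trivial⟩, hs, hs'⟩
    · exact Nat.zero_le _

lemma IsCadlagPath.gridCount_eq {x : ℝ≥0 → E} (hx : IsCadlagPath x) (R : E → E → Prop)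
    (h : ℝ≥0) (n : ℕ)
    (hsep : ∀ r ∈ transitionTimes (fun _ _ => True) x (n * h),
      ∀ s ∈ transitionTimes (fun _ _ => True) x (n * h), r < s → r + h ≤ s) :
    gridCount R x h n = (transitionTimes R x (n * h)).ncard := by
  induction n with
  | zero => simp [gridCount, transitionTimes_zero]
  | succ n ih =>
    have e : ((n + 1 : ℕ) : ℝ≥0) * h = n * h + h := by push_cast; ring
    rw [e] at hsep
    have hle : (n : ℝ≥0) * h ≤ n * h + h := le_self_add
    rw [gridCount, Finset.sum_range_succ, e, hx.ncard_transitionTimes_add _ hle]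
    congr 1
    · exact ih fun r hr s hs => hsep r ⟨hr.1.trans hle, hr.2⟩ s ⟨hs.1.trans hle, hs.2⟩
    · have huniq : ∀ r s, n * h < r → r ≤ n * h + h → (∃ a b, IsTransitionAt x r a b) →
          n * h < s → s ≤ n * h + h → (∃ a b, IsTransitionAt x s a b) → r = s := by
        have aux : ∀ r s, n * h < r → r ≤ n * h + h → (∃ a b, IsTransitionAt x r a b) →
          n * h < s → s ≤ n * h + h → (∃ a b, IsTransitionAt x s a b) → ¬ r < s := by
          rintro r s hr hr' ⟨a, b, hab⟩ hs hs' ⟨c, d, hcd⟩ hrs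
          -- The cell is open on the left, so `r + h` lies strictly beyond its right end.
          have := hsep r ⟨hr', a, b, hab, trivial⟩ s ⟨hs', c, d, hcd, trivial⟩ hrs
          exact absurd (this.trans hs') (not_le.2 (add_lt_add_left hr h))
        intro r s hr hr' hr'' hs hs' hs''
        exact le_antisymm (not_lt.1 (aux s r hs hs' hs'' hr hr' hr''))
          (not_lt.1 (aux r s hr hr' hr'' hs hs' hs''))
      split_ifs with hc
      · symm
        rw [Set.ncard_eq_one]
        obtain ⟨s, hs, hs', a, b, hab⟩ : ∃ s, n * h < s ∧ s ≤ n * h + h ∧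
            ∃ a b, IsTransitionAt x s a b := by
          by_contra! hne
          exact hc.1 (hx.eq_of_forall_not_isTransitionAt hle hne)
        have hsx := hx.eq_of_unique_isTransitionAt hs hs' hab
          fun r hr hr' hr'' => huniq r s hr hr' hr'' hs hs' ⟨a, b, hab⟩
        refine ⟨s, Set.eq_singleton_iff_unique_mem.2 ⟨⟨⟨hs', a, b, hab, ?_⟩, hs, hs'⟩, ?_⟩⟩
        · rw [← hsx.1, ← hsx.2]
          exact hc.2
        · rintro r ⟨⟨-, c, d, hcd, -⟩, hr, hr'⟩
          exact huniq r s hr hr' ⟨c, d, hcd⟩ hs hs' ⟨a, b, hab⟩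
      · symm
        rw [Set.ncard_eq_zero ((hx.finite_transitionTimes _ _).subset Set.inter_subset_left)]
        by_contra hne
        obtain ⟨s, ⟨-, a, b, hab, hR⟩, hs, hs'⟩ := Set.nonempty_iff_ne_empty.2 hne
        have hsx := hx.eq_of_unique_isTransitionAt hs hs' hab
          fun r hr hr' hr'' => huniq r s hr hr' hr'' hs hs' ⟨a, b, hab⟩
        refine hc ?_
        rw [hsx.1, hsx.2]
        exact ⟨hab.2.2.2, hR⟩

/-- A finite set of nonnegative reals has a positive separation constant. -/
lemma Set.Finite.exists_pos_add_le {S : Set ℝ≥0} (hS : S.Finite) :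
    ∃ δ : ℝ≥0, 0 < δ ∧ ∀ r ∈ S, ∀ s ∈ S, r < s → r + δ ≤ s := by
  have hT : ((S ×ˢ S) ∩ {p | p.1 < p.2}).Finite := (hS.prod hS).subset Set.inter_subset_left
  obtain ⟨δ, hδ, h⟩ : ∃ δ : ℝ≥0, 0 < δ ∧
      ∀ p ∈ ((S ×ˢ S) ∩ {p | p.1 < p.2}), δ ≤ p.2 - p.1 := by
    have : ∀ᶠ δ in 𝓝[>] (0 : ℝ≥0), ∀ p ∈ ((S ×ˢ S) ∩ {p | p.1 < p.2}), δ ≤ p.2 - p.1 := by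
      rw [hT.eventually_all]
      intro p hp
      exact mem_nhdsWithin_of_mem_nhds (Iic_mem_nhds (tsub_pos_of_lt hp.2))
    exact ((eventually_mem_nhdsWithin.and this).exists)
  refine ⟨δ, hδ, fun r hr s hs hrs => ?_⟩
  have := h (r, s) ⟨⟨hr, hs⟩, hrs⟩
  rw [add_comm]
  exact (le_tsub_iff_right hrs.le).1 this

lemma IsCadlagPath.eventually_gridCount_eq {x : ℝ≥0 → E} (hx : IsCadlagPath x)
    (R : E → E → Prop) (t : ℝ≥0) :
    ∀ᶠ n : ℕ in atTop, gridCount R x (t / n) n = (transitionTimes R x t).ncard := by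
  obtain ⟨δ, hδ, h⟩ := (hx.finite_transitionTimes (fun _ _ => True) t).exists_pos_add_le
  have hlim : Tendsto (fun n : ℕ => t / (n : ℝ≥0)) atTop (𝓝 0) :=
    tendsto_const_div_atTop_nhds_zero_nat t
  filter_upwards [hlim.eventually (Iic_mem_nhds hδ), eventually_ne_atTop 0] with n hn hn0
  have e : (n : ℝ≥0) * (t / n) = t := mul_div_cancel₀ t (Nat.cast_ne_zero.2 hn0)
  have := hx.gridCount_eq R (t / n) n
  rw [e] at this
  exact this fun r hr s hs hrs => (add_le_add_right hn r).trans (h r hr s hs hrs)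

end Paths

/-! ### Expected counts, passage to the limit, and the rate. -/

section Expectation

/-- Left Riemann sums of a continuous function converge to its integral. -/
lemma tendsto_riemannSum {f : ℝ → ℝ} (hf : Continuous f) {t : ℝ} (ht : 0 ≤ t) :
    Tendsto (fun n : ℕ => ∑ k ∈ Finset.range n, t / n * f (k * (t / n))) atTop
      (𝓝 (∫ s in (0 : ℝ)..t, f s)) := by
  rw [Metric.tendsto_atTop]
  intro ε hε
  have huc := isCompact_Icc.uniformContinuousOn_of_continuous (hf.continuousOn (s := Set.Icc 0 t))
  -- The cell errors add up to `ε * t / (t + 1) < ε`; the `+ 1` also covers `t = 0`.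
  obtain ⟨δ, hδ, hfδ⟩ := Metric.uniformContinuousOn_iff.1 huc (ε / (t + 1)) (by positivity)
  have hlim : Tendsto (fun n : ℕ => t / (n : ℝ)) atTop (𝓝 0) :=
    tendsto_const_div_atTop_nhds_zero_nat t
  obtain ⟨N, hN⟩ := eventually_atTop.1 ((hlim.eventually (Iio_mem_nhds hδ)).and
    (eventually_ne_atTop 0))
  refine ⟨N, fun n hn => ?_⟩
  obtain ⟨hnδ, hn0⟩ := hN n hn
  have hnδ : t / n < δ := hnδ
  have hn0' : (n : ℝ) ≠ 0 := Nat.cast_ne_zero.2 hn0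
  set h : ℝ := t / n with hh
  have hh0 : 0 ≤ h := by positivity
  have hnh : n * h = t := mul_div_cancel₀ t hn0'
  have hint : ∫ s in (0 : ℝ)..t, f s =
      ∑ k ∈ Finset.range n, ∫ s in (k * h)..(k + 1 : ℕ) * h, f s := by
    rw [intervalIntegral.sum_integral_adjacent_intervals (a := fun k : ℕ => (k : ℝ) * h)
      fun k _ => hf.intervalIntegrable _ _]
    simp [hnh]
  have hcell : ∀ k ∈ Finset.range n,
      ‖h * f (k * h) - ∫ s in (k * h)..(k + 1 : ℕ) * h, f s‖ ≤ ε / (t + 1) * h := by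
    intro k hk
    have hk' : ((k + 1 : ℕ) : ℝ) ≤ n := by exact_mod_cast Finset.mem_range.1 hk
    have e : ((k + 1 : ℕ) : ℝ) * h = k * h + h := by push_cast; ring
    have e' : h * f (k * h) = ∫ s in (k * h)..(k + 1 : ℕ) * h, f (k * h) := by
      rw [intervalIntegral.integral_const, e]; simp
    rw [e', ← intervalIntegral.integral_sub (by simp) (hf.intervalIntegrable _ _)]
    have hle : (k : ℝ) * h ≤ (k + 1 : ℕ) * h := by rw [e]; linarith
    have hkt : ((k + 1 : ℕ) : ℝ) * h ≤ t := by rw [← hnh]; gcongr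
    have hk0 : 0 ≤ (k : ℝ) * h := by positivity
    refine (intervalIntegral.norm_integral_le_of_norm_le_const (C := ε / (t + 1)) ?_).trans ?_
    · intro s hs
      rw [Set.uIoc_of_le hle] at hs
      rw [← dist_eq_norm]
      refine (hfδ _ ⟨hk0, hle.trans hkt⟩ s ⟨hk0.trans hs.1.le, hs.2.trans hkt⟩ ?_).le
      rw [Real.dist_eq, abs_sub_comm, abs_of_nonneg (by linarith [hs.1])]
      have := hs.2
      rw [e] at this
      linarith
    · rw [e, add_sub_cancel_left, abs_of_nonneg hh0]
  rw [dist_eq_norm, hint, ← Finset.sum_sub_distrib]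
  calc _ ≤ ∑ k ∈ Finset.range n, ε / (t + 1) * h := norm_sum_le_of_le _ hcell
    _ = ε * (t / (t + 1)) := by
      rw [Finset.sum_const, Finset.card_range, nsmul_eq_mul, ← hnh]; ring
    _ < ε * 1 := by
      gcongr
      rw [div_lt_one (by positivity)]
      linarith
    _ = ε := mul_one ε

variable {E : Type*} [Fintype E] [DecidableEq E]

/-- The probability of being in state `a` at time `u`, for initial law `α` and generator `Q`. -/
noncomputable def stateProb (α : E → ℝ) (Q : Matrix E E ℝ) (a : E) (u : ℝ) : ℝ :=
  ∑ i, α i * NormedSpace.exp (u • Q) i a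

lemma continuous_stateProb (α : E → ℝ) (Q : Matrix E E ℝ) (a : E) :
    Continuous (stateProb α Q a) := by
  refine continuous_finsetSum _ fun i _ => continuous_const.mul ?_
  exact continuous_iff_continuousAt.2 fun x => (hasDerivAt_exp_smul_apply Q i a x).continuousAt

lemma tendsto_exp_smul_apply_div (Q : Matrix E E ℝ) {a b : E} (hab : a ≠ b) :
    Tendsto (fun h : ℝ => NormedSpace.exp (h • Q) a b / h) (𝓝[≠] 0) (𝓝 (Q a b)) := by
  have := (hasDerivAt_exp_smul_apply Q a b 0).tendsto_slope
  simp only [zero_smul, NormedSpace.exp_zero, one_mul] at this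
  refine this.congr fun h => ?_
  simp [slope, NormedSpace.exp_zero, Matrix.one_apply_ne hab, div_eq_inv_mul]

open Classical in
/-- The pairs of different states related by `R`. -/
noncomputable def changePairs (R : E → E → Prop) : Finset (E × E) :=
  Finset.univ.filter fun p => p.1 ≠ p.2 ∧ R p.1 p.2

lemma gridCount_eq_sum_indicator {Ω : Type*} (R : E → E → Prop) (X : ℝ≥0 → Ω → E) (h : ℝ≥0) (n : ℕ) (ω : Ω) :
    (gridCount R (fun u => X u ω) h n : ℝ) = ∑ k ∈ Finset.range n, ∑ p ∈ changePairs R,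
      (X (k * h) ⁻¹' {p.1} ∩ X (k * h + h) ⁻¹' {p.2}).indicator (fun _ => (1 : ℝ)) ω := by
  classical
  rw [gridCount]
  push_cast
  refine Finset.sum_congr rfl fun k _ => ?_
  set a := X (k * h) ω with ha
  set b := X (k * h + h) ω with hb
  have : ∀ p : E × E, (X (k * h) ⁻¹' {p.1} ∩ X (k * h + h) ⁻¹' {p.2}).indicator
      (fun _ => (1 : ℝ)) ω = if p = (a, b) then 1 else 0 := by
    rintro ⟨c, d⟩
    simp only [Set.indicator_apply, Set.mem_inter_iff, Set.mem_preimage, Set.mem_singleton_iff,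
      ← ha, ← hb, Prod.mk.injEq]
    refine if_congr ?_ rfl rfl
    exact and_congr eq_comm eq_comm
  simp_rw [this, Finset.sum_ite_eq']
  simp [changePairs]

/-- The expected number of `R`-transitions in `(0, t]`. -/
noncomputable def meanCount (R : E → E → Prop) (α : E → ℝ) (Q : Matrix E E ℝ) (t : ℝ) : ℝ :=
  ∑ p ∈ changePairs R, (∫ s in (0 : ℝ)..t, stateProb α Q p.1 s) * Q p.1 p.2

lemma hasDerivAt_meanCount (R : E → E → Prop) (α : E → ℝ) (Q : Matrix E E ℝ) (t : ℝ) :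
    HasDerivAt (meanCount R α Q) (∑ p ∈ changePairs R, stateProb α Q p.1 t * Q p.1 p.2) t := by
  refine HasDerivAt.fun_sum fun p _ => ?_
  exact ((continuous_stateProb α Q p.1).integral_hasStrictDerivAt 0 t).hasDerivAt.mul_const _

lemma sum_changePairs_inner {W F : Finset E} (hWF : Disjoint W F) (g : E → E → ℝ) :
    ∑ p ∈ changePairs (fun a b => (a ∈ W ∧ b ∈ W) ∨ (a ∈ F ∧ b ∈ F)), g p.1 p.2 =
      (∑ w ∈ W, ∑ w₁ ∈ W with w₁ ≠ w, g w w₁) + ∑ f ∈ F, ∑ f₁ ∈ F with f₁ ≠ f, g f f₁ := by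
  classical
  have hD : ∀ V : Finset E, ∑ v ∈ V, ∑ v₁ ∈ V with v₁ ≠ v, g v v₁ =
      ∑ p ∈ Finset.univ.filter (fun p : E × E => p.1 ≠ p.2 ∧ p.1 ∈ V ∧ p.2 ∈ V), g p.1 p.2 := by
    intro V
    rw [Finset.sum_sigma']
    refine Finset.sum_bij' (fun p _ => (p.1, p.2)) (fun p _ => ⟨p.1, p.2⟩) ?_ ?_ ?_ ?_ ?_
    all_goals simp +contextual [eq_comm]
  rw [hD, hD, ← Finset.sum_union]
  · refine Finset.sum_congr ?_ fun _ _ => rfl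
    ext p
    simp only [changePairs, Finset.mem_filter, Finset.mem_univ, true_and, Finset.mem_union]
    tauto
  · rw [Finset.disjoint_left]
    intro p hp hp'
    exact Finset.disjoint_left.1 hWF (Finset.mem_filter.1 hp).2.2.1
      (Finset.mem_filter.1 hp').2.2.1

variable {Ω : Type*} [MeasurableSpace Ω] {μ : Measure Ω} {X : ℝ≥0 → Ω → E} {α : E → ℝ}
  {Q : Matrix E E ℝ}

lemma IsMarkovProcess.measureReal_pair (hX : IsMarkovProcess μ X α Q) (s t : ℝ≥0) (a b : E) :
    μ.real (X s ⁻¹' {a} ∩ X (s + t) ⁻¹' {b}) =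
      μ.real (X s ⁻¹' {a}) * NormedSpace.exp ((t : ℝ) • Q) a b := by
  obtain ⟨P, hP, hPQ, hM⟩ := hX.markov
  have := hM s t Set.univ MeasurableSet.univ a b
  rwa [Set.univ_inter, hPQ.eq_exp hP] at this

lemma IsMarkovProcess.ae_tendsto_gridCount (hX : IsMarkovProcess μ X α Q)
    (R : E → E → Prop) (t : ℝ≥0) :
    ∀ᵐ ω ∂μ, Tendsto (fun n : ℕ => (gridCount R (fun u => X u ω) (t / n) n : ℝ)) atTop
      (𝓝 ((transitionTimes R (fun u => X u ω) t).ncard : ℝ)) := by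
  filter_upwards [hX.cadlag] with ω hω
  refine tendsto_const_nhds.congr' ?_
  filter_upwards [hω.eventually_gridCount_eq R t] with n hn
  rw [hn]

variable [IsProbabilityMeasure μ]

lemma IsMarkovProcess.measureReal_state (hX : IsMarkovProcess μ X α Q) (s : ℝ≥0) (a : E) :
    μ.real (X s ⁻¹' {a}) = stateProb α Q a s := by
  have h : X s ⁻¹' {a} = ⋃ i ∈ (Finset.univ : Finset E), X 0 ⁻¹' {i} ∩ X (0 + s) ⁻¹' {a} := by
    ext ω; simp
  rw [h, measureReal_biUnion_finset]
  · exact Finset.sum_congr rfl fun i _ => by rw [hX.measureReal_pair, hX.initial]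
  · intro i _ j _ hij
    rw [Function.onFun, Set.disjoint_left]
    rintro ω ⟨hi, -⟩ ⟨hj, -⟩
    exact hij (hi.symm.trans hj)
  · exact fun i _ => (hX.measurable _ _).inter (hX.measurable _ _)

lemma IsMarkovProcess.integrable_gridCount (hX : IsMarkovProcess μ X α Q) (R : E → E → Prop)
    (h : ℝ≥0) (n : ℕ) : Integrable (fun ω => (gridCount R (fun u => X u ω) h n : ℝ)) μ := by
  simp_rw [gridCount_eq_sum_indicator]
  exact integrable_finsetSum _ fun k _ => integrable_finsetSum _ fun p _ =>
    (integrable_const _).indicator ((hX.measurable _ _).inter (hX.measurable _ _))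

lemma IsMarkovProcess.integral_gridCount (hX : IsMarkovProcess μ X α Q) (R : E → E → Prop)
    (h : ℝ≥0) (n : ℕ) : ∫ ω, (gridCount R (fun u => X u ω) h n : ℝ) ∂μ =
      ∑ k ∈ Finset.range n, ∑ p ∈ changePairs R,
        stateProb α Q p.1 (k * h) * NormedSpace.exp ((h : ℝ) • Q) p.1 p.2 := by
  simp_rw [gridCount_eq_sum_indicator]
  have hm : ∀ (k : ℕ) (p : E × E),
      MeasurableSet (X (k * h) ⁻¹' {p.1} ∩ X (k * h + h) ⁻¹' {p.2}) :=
    fun k p => (hX.measurable _ _).inter (hX.measurable _ _)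
  have hi : ∀ (k : ℕ) (p : E × E),
      Integrable ((X (k * h) ⁻¹' {p.1} ∩ X (k * h + h) ⁻¹' {p.2}).indicator
        fun _ => (1 : ℝ)) μ := fun k p => (integrable_const _).indicator (hm k p)
  rw [integral_finsetSum _ fun k _ => integrable_finsetSum _ fun p _ => hi k p]
  refine Finset.sum_congr rfl fun k _ => ?_
  rw [integral_finsetSum _ fun p _ => hi k p]
  refine Finset.sum_congr rfl fun p _ => ?_
  rw [integral_indicator_const _ (hm k p), hX.measureReal_pair, hX.measureReal_state]
  simp

lemma IsMarkovProcess.tendsto_integral_gridCount (hX : IsMarkovProcess μ X α Q)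
    (R : E → E → Prop) {t : ℝ≥0} (ht : 0 < t) :
    Tendsto (fun n : ℕ => ∫ ω, (gridCount R (fun u => X u ω) (t / n) n : ℝ) ∂μ) atTop
      (𝓝 (meanCount R α Q t)) := by
  have hlim : Tendsto (fun n : ℕ => (t : ℝ) / n) atTop (𝓝[≠] 0) := by
    refine tendsto_nhdsWithin_iff.2 ⟨tendsto_const_div_atTop_nhds_zero_nat _, ?_⟩
    filter_upwards [eventually_ne_atTop 0] with n hn
    have : (0 : ℝ) < t := ht
    exact div_ne_zero this.ne' (Nat.cast_ne_zero.2 hn)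
  -- Dividing and multiplying by the mesh splits each term into a Riemann sum and a difference
  -- quotient tending to `Q p.1 p.2`.
  have key : Tendsto (fun n : ℕ => ∑ p ∈ changePairs R,
      (∑ k ∈ Finset.range n, (t : ℝ) / n * stateProb α Q p.1 (k * (t / n))) *
        (NormedSpace.exp (((t : ℝ) / n) • Q) p.1 p.2 / (t / n))) atTop
      (𝓝 (meanCount R α Q t)) := by
    refine tendsto_finsetSum _ fun p hp => ?_
    have hne : p.1 ≠ p.2 := by
      classical
      exact (Finset.mem_filter.1 hp).2.1
    exact (tendsto_riemannSum (continuous_stateProb α Q p.1) t.2).mul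
      ((tendsto_exp_smul_apply_div Q hne).comp hlim)
  refine key.congr' ?_
  filter_upwards [hlim.eventually self_mem_nhdsWithin] with n hn
  have hn : (t : ℝ) / n ≠ 0 := hn
  rw [hX.integral_gridCount, Finset.sum_comm]
  refine Finset.sum_congr rfl fun p _ => ?_
  push_cast
  rw [← Finset.mul_sum, ← Finset.sum_mul, mul_right_comm, mul_div_cancel₀ _ hn, mul_comm]

/-- Fatou: the grid counts converge almost surely and their means converge to a finite limit. This
needs no dominating function, which is not yet available. -/
lemma IsMarkovProcess.integrable_ncard_transitionTimes (hX : IsMarkovProcess μ X α Q)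
    (R : E → E → Prop) (t : ℝ≥0) :
    Integrable (fun ω => ((transitionTimes R (fun u => X u ω) t).ncard : ℝ)) μ := by
  rcases eq_or_ne t 0 with rfl | ht
  · simp [transitionTimes_zero]
  have hmeas : ∀ n : ℕ, AEStronglyMeasurable
      (fun ω => (gridCount R (fun u => X u ω) (t / n) n : ℝ)) μ :=
    fun n => (hX.integrable_gridCount R _ n).aestronglyMeasurable
  have hlim := hX.ae_tendsto_gridCount R t
  refine ⟨aestronglyMeasurable_of_tendsto_ae atTop hmeas hlim, lt_of_le_of_lt
    (lintegral_congr_ae (hlim.mono fun ω hω => hω.enorm.liminf_eq.symm)).le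
    ((lintegral_liminf_le' fun n => (hmeas n).enorm).trans_lt ?_)⟩
  have hn : ∀ n : ℕ, ∫⁻ ω, ‖(gridCount R (fun u => X u ω) (t / n) n : ℝ)‖ₑ ∂μ =
      ENNReal.ofReal (∫ ω, (gridCount R (fun u => X u ω) (t / n) n : ℝ) ∂μ) := by
    intro n
    rw [ofReal_integral_eq_lintegral_ofReal (hX.integrable_gridCount R _ n)
      (Eventually.of_forall fun ω => Nat.cast_nonneg _)]
    refine lintegral_congr fun ω => ?_
    rw [Real.enorm_eq_ofReal (Nat.cast_nonneg _)]
  simp_rw [hn]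
  rw [(ENNReal.tendsto_ofReal
    (hX.tendsto_integral_gridCount R (pos_iff_ne_zero.2 ht))).liminf_eq]
  exact ENNReal.ofReal_lt_top

theorem IsMarkovProcess.integral_ncard_transitionTimes (hX : IsMarkovProcess μ X α Q)
    (R : E → E → Prop) (t : ℝ≥0) :
    ∫ ω, ((transitionTimes R (fun u => X u ω) t).ncard : ℝ) ∂μ = meanCount R α Q t := by
  rcases eq_or_ne t 0 with rfl | ht
  · simp [transitionTimes_zero, meanCount]
  refine tendsto_nhds_unique ?_ (hX.tendsto_integral_gridCount R (pos_iff_ne_zero.2 ht))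
  -- The dominating function is the count of all transitions, integrable by the preceding lemma with
  -- the trivial relation.
  refine tendsto_integral_filter_of_dominated_convergence _
    (Eventually.of_forall fun n => (hX.integrable_gridCount R _ n).aestronglyMeasurable) ?_
    (hX.integrable_ncard_transitionTimes (fun _ _ => True) t) (hX.ae_tendsto_gridCount R t)
  filter_upwards [eventually_ne_atTop 0] with n hn
  filter_upwards [hX.cadlag] with ω hω
  have := hω.gridCount_le R (t / n) n
  rw [mul_div_cancel₀ t (Nat.cast_ne_zero.2 hn)] at this
  rw [Real.norm_of_nonneg (Nat.cast_nonneg _)]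
  exact_mod_cast this

end Expectation

theorem mainTheorem1 {Ω E : Type*} [MeasurableSpace Ω] [Fintype E] [DecidableEq E]
    (μ : Measure Ω) [IsProbabilityMeasure μ] (X : ℝ≥0 → Ω → E) (α : E → ℝ) (Q : Matrix E E ℝ)
    (hX : IsMarkovProcess μ X α Q) (W F : Finset E) (hWF : IsCompl W F) :
    (∀ᵐ ω ∂μ, ∀ t, innerTransitionCount W F (fun u => X u ω) t ≠ ⊤) ∧
    (∀ t, Integrable (innerCount W F X t) μ) ∧
    ∀ t : ℝ≥0, IsROI μ W F X t
      (∑ i, ((∑ w ∈ W, ∑ w₁ ∈ W with w₁ ≠ w,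
                α i * NormedSpace.exp ((t : ℝ) • Q) i w * Q w w₁) +
             (∑ f ∈ F, ∑ f₁ ∈ F with f₁ ≠ f,
                α i * NormedSpace.exp ((t : ℝ) • Q) i f * Q f f₁))) := by
  -- `ncard` is by definition `encard` followed by `toNat`, so `innerCount` unfolds to the count
  -- already treated.
  have hint : ∀ t, Integrable (innerCount W F X t) μ := fun t =>
    hX.integrable_ncard_transitionTimes _ t
  refine ⟨?_, hint, fun t => ?_⟩
  · filter_upwards [hX.cadlag] with ω hω t
    exact Set.encard_ne_top_iff.2 (hω.finite_transitionTimes _ t)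
  · have hmean : ∀ u : ℝ≥0, ∫ ω, innerCount W F X u ω ∂μ =
        meanCount (fun a b => (a ∈ W ∧ b ∈ W) ∨ (a ∈ F ∧ b ∈ F)) α Q u := fun u =>
      hX.integral_ncard_transitionTimes _ u
    have hsum : (∑ i, ((∑ w ∈ W, ∑ w₁ ∈ W with w₁ ≠ w,
                α i * NormedSpace.exp ((t : ℝ) • Q) i w * Q w w₁) +
             (∑ f ∈ F, ∑ f₁ ∈ F with f₁ ≠ f,
                α i * NormedSpace.exp ((t : ℝ) • Q) i f * Q f f₁))) =
        ∑ p ∈ changePairs (fun a b => (a ∈ W ∧ b ∈ W) ∨ (a ∈ F ∧ b ∈ F)),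
          stateProb α Q p.1 t * Q p.1 p.2 := by
      simp_rw [stateProb, Finset.sum_mul]
      rw [Finset.sum_comm]
      exact Finset.sum_congr rfl fun i _ => (sum_changePairs_inner hWF.disjoint
        fun a b => α i * NormedSpace.exp ((t : ℝ) • Q) i a * Q a b).symm
    rw [IsROI, hsum]
    -- `meanCount` is differentiable on all of `ℝ`, so the two-sided limit restricts to the
    -- admissible increments, even at `t = 0`.
    have hd := (hasDerivAt_iff_tendsto_slope_zero.1 (hasDerivAt_meanCount
      (fun a b => (a ∈ W ∧ b ∈ W) ∨ (a ∈ F ∧ b ∈ F)) α Q t)).mono_left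
      (nhdsWithin_mono 0 (s := {Δ : ℝ | Δ ≠ 0 ∧ 0 ≤ (t : ℝ) + Δ}) fun Δ hΔ => hΔ.1)
    refine hd.congr' ?_
    filter_upwards [self_mem_nhdsWithin] with Δ hΔ
    rw [integral_sub (hint _) (hint _), hmean, hmean, Real.coe_toNNReal _ hΔ.2, smul_eq_mul,
      div_eq_inv_mul]
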